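/- For real $\nu$ and $x>0$ let $$I_\nu(x)=\sum_{k=0}^\infty \frac{1}{k!\,\Gamma(\nu+k+1)}\Big(\frac{x}{2}\Big)^{\nu+2k}$$ be the modified Bessel function of the first kind (with $1/\Gamma=0$ at the poles of $\Gamma$). Let $0<\gamma<1$ and let $n>-1$ be real. Then, for all $x>0$, the following integrals converge and \begin{align*} \text{(1)}\quad &\int_0^x \mathrm{e}^{-\gamma t}t^\nu I_{\nu+n}(t)\,\mathrm{d}t>\mathrm{e}^{-\gamma x}x^\nu I_{\nu+n+1}(x), && \nu>-\tfrac12(n+1),\\ \text{(2)}\quad &\int_0^x t^\nu I_{\nu+n}(t)\,\mathrm{d}t<\frac{x^\nu}{2\nu+n+1}\Big(2(\nu+n+1)I_{\nu+n+1}(x)-(n+1)I_{\nu+n+3}(x)\Big), && \nu>-\tfrac12(n+1),\\ \text{(3)}\quad &\frac{x^\nu}{2\nu+n+1}\Big(2(\nu+n+1)I_{\nu+n+1}(x)-(n+1)I_{\nu+n+3}(x)\Big)<\frac{2(\nu+n+1)}{2\nu+n+1}x^\nu I_{\nu+n+1}(x), && \nu>-\tfrac12(n+1),\\ \text{(4)}\quad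 &\int_0^x \mathrm{e}^{-\gamma t}t^{\nu}I_\nu(t)\,\mathrm{d}t<\frac{\mathrm{e}^{-\gamma x}x^\nu}{(2\nu+1)(1-\gamma)}\Big(2(\nu+1)I_{\nu+1}(x)-I_{\nu+3}(x)\Big), && \nu\geq\tfrac12,\\ \text{(5)}\quad &\int_0^x \mathrm{e}^{-\gamma t}t^{\nu+1} I_{\nu}(t)\,\mathrm{d}t>\mathrm{e}^{-\gamma x}x^{\nu+1} I_{\nu+1}(x), && \nu>-1,\\ \text{(6)}\quad &\int_0^x \mathrm{e}^{-\gamma t}t^{\nu+1} I_{\nu}(t)\,\mathrm{d}t<\frac{1}{1-\gamma}\,\mathrm{e}^{-\gamma x}x^{\nu+1} I_{\nu+1}(x), && \nu>-\tfrac12. \end{align*} Inequalities (1) and (5) hold for all $\gamma>0$. For each fixed choice of the parameters in the stated ranges, the constants in the following bounds cannot be improved: the constant $\frac{2(\nu+n+1)}{2\nu+n+1}$ in the bound $\int_0^x t^\nu I_{\nu+n}(t)\,\mathrm{d}t<\frac{2(\nu+n+1)}{2\nu+n+1}x^\nu I_{\nu+n+1}(x)$ given by (2) and (3), and the constant $\frac1{1-\gamma}$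 in (6), cannot be replaced by any smaller number, and the constant $1$ in (5) (for any $\gamma>0$) cannot be replaced by any larger number, if the bound, even with a non-strict inequality sign, is to hold for all $x>0$. -/

import Mathlib

/-- The modified Bessel function of the first kind of real order `ν`, for `x > 0`:
`I_ν(x) = ∑_{k ≥ 0} (x/2)^(ν+2k) / (k! Γ(ν+k+1))`, with the factor `(x/2)^ν` pulled out of the sum.
When `ν+k+1` is a pole of `Γ` the term is `0`, in agreement with the convention `1/Γ = 0` there
(`Real.Gamma` takes the value `0` at its poles and division by `0` gives `0`). -/
noncomputable def besselI (ν x : ℝ) : ℝ :=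
  (x / 2) ^ ν * ∑' k : ℕ, (x / 2) ^ (2 * k) / ((k.factorial : ℝ) * Real.Gamma (ν + k + 1))

/-- The series that defines `besselI` converges, for all real `ν` and `x`. -/
theorem summable_besselI (ν x : ℝ) :
    Summable fun k : ℕ => (x / 2) ^ (2 * k) / ((k.factorial : ℝ) * Real.Gamma (ν + k + 1)) := by
  refine Summable.of_norm_bounded_eventually_nat (Real.summable_pow_div_factorial ((x / 2) ^ 2)) ?_
  have h1 : ∀ᶠ k : ℕ in Filter.atTop, (1 - ν : ℝ) ≤ k :=
    tendsto_natCast_atTop_atTop.eventually_ge_atTop _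
  filter_upwards [h1] with k hk
  have hG : 1 ≤ Real.Gamma (ν + k + 1) := by
    have := Real.Gamma_strictMonoOn_Ici.monotoneOn (a := 2) (b := ν + k + 1)
      (by simp) (by simp; linarith) (by linarith)
    rwa [Real.Gamma_two] at this
  have hk0 : (0 : ℝ) < k.factorial := by exact_mod_cast k.factorial_pos
  have hx : 0 ≤ (x / 2) ^ (2 * k) := by rw [pow_mul]; positivity
  rw [Real.norm_of_nonneg (by positivity), ← pow_mul]
  gcongr
  nlinarith

/-! Write `W_μ(t) = e^{-γt} t^a I_μ(t)`. The Bessel relations give `W_{μ+1}' = W_μ - ((μ+1-a)/x + γ)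
W_{μ+1}`. Every bound compares an integral `∫₀ˣ W_μ` with a combination of weighted Bessel functions
or, for the exponential bound with weight `t^ν`, first with a damped unweighted integral. Both sides
tend to `0` at `0+`, so it is enough to compare derivatives. Besides positivity, this uses the
three-term recurrence and, in the upper bounds containing `1 - γ`, the inequality `I_{μ+1} < I_μ`
for `μ ≥ -1/2`.

The constants `2(ν+n+1)/(2ν+n+1)` and `1` are forced by `x → 0`. The constant `1/(1-γ)` is forced by
`x → ∞`, where `I_{μ+1}/I_μ` gets arbitrarily close to `1`; this too follows from a monotonicity
argument, without an asymptotic expansion. -/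

open Filter Topology Set

/-! ### Power series, derivatives and recurrence -/

/-- The entire series `∑ y ^ k / (k! Γ(μ + k + 1))`, so that `I_μ(x) = (x/2)^μ S_μ((x/2)²)`. -/
noncomputable def besselS (μ y : ℝ) : ℝ :=
  ∑' k : ℕ, y ^ k / ((k.factorial : ℝ) * Real.Gamma (μ + k + 1))

theorem besselI_eq (μ x : ℝ) : besselI μ x = (x / 2) ^ μ * besselS μ ((x / 2) ^ 2) := by
  simp only [besselI, besselS, pow_mul]

theorem summable_besselS (μ : ℝ) {y : ℝ} (hy : 0 ≤ y) :
    Summable fun k : ℕ => y ^ k / ((k.factorial : ℝ) * Real.Gamma (μ + k + 1)) := by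
  have h := summable_besselI μ (2 * √y)
  simpa [pow_mul, Real.sq_sqrt hy] using h

theorem Gamma_add_nat_pos {μ : ℝ} (hμ : -1 < μ) (k : ℕ) : 0 < Real.Gamma (μ + k + 1) := by
  have := k.cast_nonneg (α := ℝ)
  exact Real.Gamma_pos_of_pos (by linarith)

theorem besselS_zero (μ : ℝ) : besselS μ 0 = 1 / Real.Gamma (μ + 1) := by
  rw [besselS, tsum_eq_single 0 (fun k hk => by simp [hk])]
  simp

theorem besselS_zero_le {μ y : ℝ} (hμ : -1 < μ) (hy : 0 ≤ y) : besselS μ 0 ≤ besselS μ y := by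
  have h := (summable_besselS μ hy).le_tsum 0 (fun k _ => by
    have := Gamma_add_nat_pos hμ k
    positivity)
  rw [besselS_zero]
  simpa [besselS] using h

theorem besselS_zero_pos {μ : ℝ} (hμ : -1 < μ) : 0 < besselS μ 0 := by
  rw [besselS_zero]
  have := Real.Gamma_pos_of_pos (s := μ + 1) (by linarith)
  positivity

theorem besselS_pos {μ y : ℝ} (hμ : -1 < μ) (hy : 0 ≤ y) : 0 < besselS μ y :=
  (besselS_zero_pos hμ).trans_le (besselS_zero_le hμ hy)

theorem besselI_pos {μ x : ℝ} (hμ : -1 < μ) (hx : 0 < x) : 0 < besselI μ x := by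
  rw [besselI_eq]
  have := besselS_pos hμ (sq_nonneg (x / 2))
  positivity

theorem besselS_term_succ (μ y : ℝ) (k : ℕ) :
    (k + 1 : ℕ) * y ^ k / (((k + 1).factorial : ℝ) * Real.Gamma (μ + (k + 1 : ℕ) + 1)) =
      y ^ k / ((k.factorial : ℝ) * Real.Gamma (μ + 1 + k + 1)) := by
  have h : (k.factorial : ℝ) ≠ 0 := by positivity
  have h' : (k : ℝ) + 1 ≠ 0 := by positivity
  rw [Nat.factorial_succ, show μ + 1 + k + 1 = μ + (k + 1 : ℕ) + 1 by push_cast; ring]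
  push_cast
  rw [mul_assoc, mul_div_mul_left _ _ h']

theorem hasDerivAt_besselS {μ : ℝ} (hμ : -1 < μ) (y : ℝ) :
    HasDerivAt (besselS μ) (besselS (μ + 1) y) y := by
  -- The coefficients are positive for `μ > -1`, so the differentiated series at `R` majorizes it on
  -- the whole ball, which contains both `0` and `y`.
  set R : ℝ := |y| + 1 with hR
  have hR0 : 0 ≤ R := by positivity
  let g' : ℕ → ℝ → ℝ := fun k z => k * z ^ (k - 1) / ((k.factorial : ℝ) * Real.Gamma (μ + k + 1))
  have hsucc : ∀ z, (fun k => g' (k + 1) z) =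
      fun k : ℕ => z ^ k / ((k.factorial : ℝ) * Real.Gamma (μ + 1 + k + 1)) := fun z =>
    funext fun k => besselS_term_succ μ z k
  have hu : Summable fun k => g' k R := by
    rw [← summable_nat_add_iff 1, hsucc R]
    exact summable_besselS _ hR0
  have hb : ∀ k z, z ∈ Metric.ball (0 : ℝ) R → ‖g' k z‖ ≤ g' k R := by
    intro k z hz
    have hz' : |z| ≤ R := by simpa using (mem_ball_zero_iff.1 hz).le
    have hG := Gamma_add_nat_pos hμ k
    have : ‖g' k z‖ = k * |z| ^ (k - 1) / ((k.factorial : ℝ) * Real.Gamma (μ + k + 1)) := by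
      simp only [g', norm_div, norm_mul, norm_pow, Real.norm_eq_abs, abs_of_pos hG, Nat.abs_cast]
    rw [this]
    simp only [g']
    gcongr
  have hy : y ∈ Metric.ball (0 : ℝ) R := by simp [hR]
  have h := hasDerivAt_tsum_of_isPreconnected hu Metric.isOpen_ball
    (convex_ball (0 : ℝ) R).isPreconnected
    (g := fun (k : ℕ) (z : ℝ) => z ^ k / ((k.factorial : ℝ) * Real.Gamma (μ + k + 1)))
    (fun k z _ => (hasDerivAt_pow k z).div_const _) hb (y₀ := 0) (by simp [hR]; positivity)
    (summable_besselS μ le_rfl) hy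
  have hs : Summable fun k => g' k y :=
    Summable.of_norm_bounded hu fun k => hb k y hy
  have he : ∑' k, g' k y = besselS (μ + 1) y := by
    rw [hs.tsum_eq_zero_add, hsucc y]
    simp [g', besselS]
  rw [← he]
  exact h

theorem continuous_besselS {μ : ℝ} (hμ : -1 < μ) : Continuous (besselS μ) :=
  continuous_iff_continuousAt.2 fun y => (hasDerivAt_besselS hμ y).continuousAt

/-- Coefficientwise this is `Γ(μ+k+2) = (μ+k+1) Γ(μ+k+1)` with `μ+k+1` split as `(μ+1) + k`; the
part with factor `k` is the shifted series. -/
theorem besselS_recurrence {μ y : ℝ} (hμ : -1 < μ) (hy : 0 ≤ y) :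
    besselS μ y = (μ + 1) * besselS (μ + 1) y + y * besselS (μ + 2) y := by
  have h1 := summable_besselS (μ + 1) hy
  have hs : ∀ k : ℕ,
      (k + 1 : ℕ) * y ^ (k + 1) / (((k + 1).factorial : ℝ) *
        Real.Gamma (μ + 1 + (k + 1 : ℕ) + 1)) =
      y * (y ^ k / ((k.factorial : ℝ) * Real.Gamma (μ + 2 + k + 1))) := by
    intro k
    have := besselS_term_succ (μ + 1) y k
    rw [show μ + 1 + 1 = μ + 2 by ring] at this
    rw [← this]
    ring
  have h2 : Summable fun k : ℕ =>
      (k : ℝ) * y ^ k / ((k.factorial : ℝ) * Real.Gamma (μ + 1 + k + 1)) := by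
    rw [← summable_nat_add_iff 1]
    simp only [hs]
    exact (summable_besselS (μ + 2) hy).mul_left y
  have h3 : y * besselS (μ + 2) y =
      ∑' k : ℕ, (k : ℝ) * y ^ k / ((k.factorial : ℝ) * Real.Gamma (μ + 1 + k + 1)) := by
    rw [h2.tsum_eq_zero_add]
    simp only [hs, tsum_mul_left, besselS]
    simp
  rw [h3, besselS, besselS, ← tsum_mul_left, ← (h1.mul_left (μ + 1)).tsum_add h2]
  refine tsum_congr fun k => ?_
  have hk := k.cast_nonneg (α := ℝ)
  have hG := Gamma_add_nat_pos hμ k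
  have hf : (k.factorial : ℝ) ≠ 0 := by positivity
  have hne : μ + k + 1 ≠ 0 := by linarith
  rw [show μ + 1 + k + 1 = (μ + k + 1) + 1 by ring, Real.Gamma_add_one hne]
  field_simp
  ring

theorem hasDerivAt_besselI {μ x : ℝ} (hμ : -1 < μ) (hx : 0 < x) :
    HasDerivAt (besselI μ) (besselI (μ + 1) x + μ / x * besselI μ x) x := by
  have h2 : HasDerivAt (fun t : ℝ => t / 2) (1 / 2) x := (hasDerivAt_id x).div_const 2
  have h := (h2.rpow_const (p := μ) (Or.inl (by positivity))).mul
    ((hasDerivAt_besselS hμ ((x / 2) ^ 2)).comp x (h2.pow 2))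
  have he : besselI μ = fun t => (t / 2) ^ μ * besselS μ ((t / 2) ^ 2) :=
    funext fun t => besselI_eq μ t
  rw [he]
  refine h.congr_deriv ?_
  have hx2 : 0 < x / 2 := by positivity
  simp only [besselI_eq, Function.comp, Pi.pow_apply, Real.rpow_sub_one hx2.ne', Real.rpow_add_one hx2.ne']
  field_simp
  ring

theorem besselI_recurrence {μ x : ℝ} (hμ : -1 < μ) (hx : 0 < x) :
    besselI μ x = besselI (μ + 2) x + 2 * (μ + 1) / x * besselI (μ + 1) x := by
  have hx2 : 0 < x / 2 := by positivity
  simp only [besselI_eq]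
  rw [besselS_recurrence hμ (sq_nonneg (x / 2)), Real.rpow_add_one hx2.ne',
    show μ + 2 = μ + (2 : ℕ) by norm_num, Real.rpow_add_natCast hx2.ne']
  field_simp
  ring

theorem hasDerivAt_besselI_add_one {μ x : ℝ} (hμ : -1 < μ) (hx : 0 < x) :
    HasDerivAt (besselI (μ + 1)) (besselI μ x - (μ + 1) / x * besselI (μ + 1) x) x := by
  refine (hasDerivAt_besselI (by linarith) hx).congr_deriv ?_
  rw [besselI_recurrence hμ hx, show μ + 1 + 1 = μ + 2 by ring]
  ring

/-! ### Weighted Bessel functions and their integrals -/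

/-- The weighted function `e^{-γt} t^a I_μ(t)`. -/
noncomputable def besselW (γ a μ t : ℝ) : ℝ := Real.exp (-γ * t) * t ^ a * besselI μ t

theorem besselW_pos {γ a μ x : ℝ} (hμ : -1 < μ) (hx : 0 < x) : 0 < besselW γ a μ x := by
  have := besselI_pos hμ hx
  unfold besselW
  positivity

/-- Isolates the only factor singular at `0`; the rest is continuous on the whole line. Hence the
conditions `a + μ > -1` for integrability and `a + μ > 0` for a zero limit. -/
theorem besselW_eq {γ a μ t : ℝ} (ht : 0 < t) :
    besselW γ a μ t =
      t ^ (a + μ) * (Real.exp (-γ * t) * (2 ^ μ)⁻¹ * besselS μ ((t / 2) ^ 2)) := by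
  rw [besselW, besselI_eq, Real.div_rpow ht.le (by norm_num), Real.rpow_add ht]
  ring

theorem continuous_besselW_factor {γ μ : ℝ} (hμ : -1 < μ) :
    Continuous fun t => Real.exp (-γ * t) * (2 ^ μ)⁻¹ * besselS μ ((t / 2) ^ 2) := by
  have := (continuous_besselS hμ).comp (f := fun t : ℝ => (t / 2) ^ 2) (by fun_prop)
  exact Continuous.mul (by fun_prop) this

theorem intervalIntegrable_besselW {γ a μ x : ℝ} (hμ : -1 < μ) (h : -1 < a + μ) (hx : 0 < x) :
    IntervalIntegrable (besselW γ a μ) MeasureTheory.volume 0 x := by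
  have h1 := (intervalIntegral.intervalIntegrable_rpow' (a := 0) (b := x) h).mul_continuousOn
    (continuous_besselW_factor (γ := γ) hμ).continuousOn
  refine h1.congr fun t ht => ?_
  rw [uIoc_of_le hx.le] at ht
  exact (besselW_eq ht.1).symm

theorem tendsto_besselW_zero {γ a μ : ℝ} (hμ : -1 < μ) (h : 0 < a + μ) :
    Tendsto (besselW γ a μ) (𝓝[>] 0) (𝓝 0) := by
  have h1 : Tendsto (fun t : ℝ => t ^ (a + μ) *
      (Real.exp (-γ * t) * (2 ^ μ)⁻¹ * besselS μ ((t / 2) ^ 2))) (𝓝 0) (𝓝 0) := by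
    have h2 := ((Real.continuousAt_rpow_const 0 (a + μ) (Or.inr h.le)).mul
      (continuous_besselW_factor (γ := γ) hμ).continuousAt).tendsto
    simpa [Real.zero_rpow h.ne', Pi.mul_def] using h2
  refine (h1.mono_left nhdsWithin_le_nhds).congr' ?_
  filter_upwards [self_mem_nhdsWithin] with t ht
  exact (besselW_eq ht).symm

theorem hasDerivAt_besselW {γ a μ x : ℝ} (hμ : -1 < μ) (hx : 0 < x) :
    HasDerivAt (besselW γ a (μ + 1))
      (besselW γ a μ x - ((μ + 1 - a) / x + γ) * besselW γ a (μ + 1) x) x := by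
  have h1 : HasDerivAt (fun t => Real.exp (-γ * t)) (Real.exp (-γ * x) * (-γ * 1)) x :=
    ((hasDerivAt_id x).const_mul (-γ)).exp
  have h := (h1.mul (Real.hasDerivAt_rpow_const (p := a) (Or.inl hx.ne'))).mul
    (hasDerivAt_besselI_add_one hμ hx)
  refine h.congr_deriv ?_
  simp only [besselW, Pi.mul_apply, Real.rpow_sub_one hx.ne']
  field_simp
  ring

theorem continuousAt_besselW {γ a μ x : ℝ} (hμ : -1 < μ) (hx : 0 < x) :
    ContinuousAt (besselW γ a μ) x :=
  ((by fun_prop : ContinuousAt (fun t => Real.exp (-γ * t)) x).mul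
    (Real.continuousAt_rpow_const x a (Or.inl hx.ne'))).mul (hasDerivAt_besselI hμ hx).continuousAt

theorem hasDerivAt_integral_besselW {γ a μ x : ℝ} (hμ : -1 < μ) (h : -1 < a + μ) (hx : 0 < x) :
    HasDerivAt (fun y => ∫ t in (0 : ℝ)..y, besselW γ a μ t) (besselW γ a μ x) x :=
  intervalIntegral.integral_hasDerivAt_right (intervalIntegrable_besselW hμ h hx)
    (ContinuousOn.stronglyMeasurableAtFilter isOpen_Ioi
      (fun _ hy => (continuousAt_besselW hμ hy).continuousWithinAt) x hx)
    (continuousAt_besselW hμ hx)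

theorem tendsto_integral_besselW_zero {γ a μ : ℝ} (hμ : -1 < μ) (h : -1 < a + μ) :
    Tendsto (fun y => ∫ t in (0 : ℝ)..y, besselW γ a μ t) (𝓝[>] 0) (𝓝 0) := by
  have hi := intervalIntegrable_besselW (γ := γ) hμ h one_pos
  have hc := intervalIntegral.continuousOn_primitive_interval ((intervalIntegrable_iff' (by simp)).1 hi)
  have h0 := (hc 0 (by simp)).tendsto
  rw [uIcc_of_le zero_le_one, intervalIntegral.integral_same] at h0
  rw [← nhdsWithin_Ioc_eq_nhdsGT (zero_lt_one' ℝ)]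
  exact h0.mono_left (nhdsWithin_mono _ Ioc_subset_Icc_self)

/-! ### Comparison of functions through their derivatives -/

theorem monotoneOn_Ioi_of_hasDerivAt {f f' : ℝ → ℝ} {c : ℝ}
    (hf : ∀ x, c < x → HasDerivAt f (f' x) x) (h : ∀ x, c < x → 0 ≤ f' x) :
    MonotoneOn f (Ioi c) := by
  refine monotoneOn_of_deriv_nonneg (convex_Ioi c)
    (fun x hx => (hf x hx).continuousAt.continuousWithinAt) ?_ ?_
  · rw [interior_Ioi]
    exact fun x hx => (hf x hx).differentiableAt.differentiableWithinAt
  · rw [interior_Ioi]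
    exact fun x hx => (hf x hx).deriv ▸ h x hx

theorem strictMonoOn_Ioi_of_hasDerivAt {f f' : ℝ → ℝ} {c : ℝ}
    (hf : ∀ x, c < x → HasDerivAt f (f' x) x) (h : ∀ x, c < x → 0 < f' x) :
    StrictMonoOn f (Ioi c) := by
  refine strictMonoOn_of_deriv_pos (convex_Ioi c)
    (fun x hx => (hf x hx).continuousAt.continuousWithinAt) ?_
  rw [interior_Ioi]
  exact fun x hx => (hf x hx).deriv ▸ h x hx

theorem MonotoneOn.le_of_tendsto_nhdsGT {f : ℝ → ℝ} {c l x : ℝ} (hf : MonotoneOn f (Ioi c))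
    (hl : Tendsto f (𝓝[>] c) (𝓝 l)) (hx : c < x) : l ≤ f x := by
  refine le_of_tendsto hl ?_
  filter_upwards [Ioo_mem_nhdsGT hx] with y hy
  exact hf hy.1 hx hy.2.le

theorem StrictMonoOn.lt_of_tendsto_nhdsGT {f : ℝ → ℝ} {c l x : ℝ} (hf : StrictMonoOn f (Ioi c))
    (hl : Tendsto f (𝓝[>] c) (𝓝 l)) (hx : c < x) : l < f x := by
  obtain ⟨y, hy, hyx⟩ := exists_between hx
  exact (hf.monotoneOn.le_of_tendsto_nhdsGT hl hy).trans_lt (hf hy hx hyx)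

theorem le_of_hasDerivAt_le {f g f' g' : ℝ → ℝ} {c l x : ℝ}
    (hf : ∀ x, c < x → HasDerivAt f (f' x) x) (hg : ∀ x, c < x → HasDerivAt g (g' x) x)
    (h : ∀ x, c < x → f' x ≤ g' x) (hfl : Tendsto f (𝓝[>] c) (𝓝 l))
    (hgl : Tendsto g (𝓝[>] c) (𝓝 l)) (hx : c < x) : f x ≤ g x := by
  have hm := monotoneOn_Ioi_of_hasDerivAt (fun x hx => (hg x hx).sub (hf x hx))
    (fun x hx => sub_nonneg.2 (h x hx))
  exact sub_nonneg.1 (hm.le_of_tendsto_nhdsGT (by simpa [Pi.sub_def] using hgl.sub hfl) hx)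

theorem lt_of_hasDerivAt_lt {f g f' g' : ℝ → ℝ} {c l x : ℝ}
    (hf : ∀ x, c < x → HasDerivAt f (f' x) x) (hg : ∀ x, c < x → HasDerivAt g (g' x) x)
    (h : ∀ x, c < x → f' x < g' x) (hfl : Tendsto f (𝓝[>] c) (𝓝 l))
    (hgl : Tendsto g (𝓝[>] c) (𝓝 l)) (hx : c < x) : f x < g x := by
  have hm := strictMonoOn_Ioi_of_hasDerivAt (fun x hx => (hg x hx).sub (hf x hx))
    (fun x hx => sub_pos.2 (h x hx))
  exact sub_pos.1 (hm.lt_of_tendsto_nhdsGT (by simpa [Pi.sub_def] using hgl.sub hfl) hx)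

/-! ### Lower bounds, and the upper bound without exponential -/

theorem besselW_mul_exp (γ a μ t : ℝ) :
    besselW γ a μ t = Real.exp (-γ * t) * besselW 0 a μ t := by
  simp [besselW, mul_assoc]

theorem besselW_recurrence {γ a μ x : ℝ} (hμ : -1 < μ) (hx : 0 < x) :
    besselW γ a μ x = besselW γ a (μ + 2) x + 2 * (μ + 1) / x * besselW γ a (μ + 1) x := by
  simp only [besselW]
  rw [besselI_recurrence hμ hx]
  ring

theorem besselW_add_one_lt_integral {γ a μ x : ℝ} (hγ : 0 < γ) (hμ : -1 < μ) (ha : a ≤ μ + 1)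
    (h : -1 < a + μ) (hx : 0 < x) :
    besselW γ a (μ + 1) x < ∫ t in (0 : ℝ)..x, besselW γ a μ t := by
  refine lt_of_hasDerivAt_lt (fun x hx => hasDerivAt_besselW hμ hx)
    (fun x hx => hasDerivAt_integral_besselW hμ h hx) (fun x hx => ?_)
    (tendsto_besselW_zero (by linarith) (by linarith)) (tendsto_integral_besselW_zero hμ h) hx
  have h1 : 0 < besselW γ a (μ + 1) x := besselW_pos (by linarith) hx
  have h2 : 0 ≤ (μ + 1 - a) / x := div_nonneg (by linarith) hx.le
  have := mul_pos (add_pos_of_nonneg_of_pos h2 hγ) h1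
  linarith

/-- After multiplication by `a + μ + 1`, the recurrence shows that the derivative of the right side
exceeds that of the left by exactly `(μ+1-a)(μ+3-a)/x · W_{μ+3} > 0`. -/
theorem integral_besselW_zero_lt {a μ x : ℝ} (hμ : -1 < μ) (ha : a < μ + 1)
    (h : -1 < a + μ) (hx : 0 < x) :
    ∫ t in (0 : ℝ)..x, besselW 0 a μ t <
      1 / (a + μ + 1) *
        (2 * (μ + 1) * besselW 0 a (μ + 1) x - (μ + 1 - a) * besselW 0 a (μ + 3) x) := by
  have h3 : μ + 3 = μ + 2 + 1 := by ring
  refine lt_of_hasDerivAt_lt (fun x hx => hasDerivAt_integral_besselW hμ h hx)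
    (fun x hx => (((hasDerivAt_besselW hμ hx).const_mul (2 * (μ + 1))).sub
      ((h3 ▸ hasDerivAt_besselW (μ := μ + 2) (by linarith) hx).const_mul (μ + 1 - a))).const_mul
        (1 / (a + μ + 1))) (fun x hx => ?_)
    (tendsto_integral_besselW_zero hμ h) ?_ hx
  · have hr := besselW_recurrence (γ := 0) (a := a) hμ hx
    have h1 : 0 < besselW 0 a (μ + 3) x := besselW_pos (by linarith) hx
    have hD : 0 < a + μ + 1 := by linarith
    have h4 : 0 < μ + 1 - a := by linarith
    have h5 : 0 < μ + 3 - a := by linarith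
    have hp : 0 < (μ + 1 - a) * (μ + 3 - a) / x * besselW 0 a (μ + 3) x := by positivity
    rw [one_div, lt_inv_mul_iff₀ hD]
    generalize besselW 0 a (μ + 3) x = w3 at *
    have hr' : 2 * (μ + 1) * besselW 0 a (μ + 1) x / x =
      besselW 0 a μ x - besselW 0 a (μ + 2) x := by rw [hr]; ring
    have e : 2 * (μ + 1) * (besselW 0 a μ x - ((μ + 1 - a) / x + 0) * besselW 0 a (μ + 1) x) -
        (μ + 1 - a) * (besselW 0 a (μ + 2) x - ((μ + 3 - a) / x + 0) * w3) =
        2 * (μ + 1) * besselW 0 a μ x -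
          (μ + 1 - a) * (2 * (μ + 1) * besselW 0 a (μ + 1) x / x) -
        (μ + 1 - a) * besselW 0 a (μ + 2) x + (μ + 1 - a) * (μ + 3 - a) / x * w3 := by ring
    rw [e, hr']
    linarith
  · have t1 := (tendsto_besselW_zero (γ := 0) (a := a) (μ := μ + 1) (by linarith)
      (by linarith)).const_mul (2 * (μ + 1))
    have t2 := (tendsto_besselW_zero (γ := 0) (a := a) (μ := μ + 3) (by linarith)
      (by linarith)).const_mul (μ + 1 - a)
    simpa using (t1.sub t2).const_mul (1 / (a + μ + 1))

/-! ### Monotonicity in the order -/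

/-- `e^x x^{-μ} (I_μ(x) - I_{μ+1}(x))` has derivative `(2μ+1) e^x x^{-μ-1} I_{μ+1}(x)`. -/
theorem hasDerivAt_besselW_sub {μ x : ℝ} (hμ : -1 < μ) (hx : 0 < x) :
    HasDerivAt (fun t => besselW (-1) (-μ) μ t - besselW (-1) (-μ) (μ + 1) t)
      ((2 * μ + 1) / x * besselW (-1) (-μ) (μ + 1) x) x := by
  have h1 : HasDerivAt (besselW (-1) (-μ) μ)
      (besselW (-1) (-μ) μ x + besselW (-1) (-μ) (μ + 1) x) x := by
    have he : HasDerivAt (fun t => Real.exp (-(-1) * t)) (Real.exp (-(-1) * x) * (-(-1) * 1)) x :=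
      ((hasDerivAt_id x).const_mul (-(-1))).exp
    have h := (he.mul (Real.hasDerivAt_rpow_const (p := -μ) (Or.inl hx.ne'))).mul
      (hasDerivAt_besselI hμ hx)
    refine h.congr_deriv ?_
    simp only [besselW, Pi.mul_apply, Real.rpow_sub_one hx.ne']
    field_simp
    ring
  refine (h1.sub (hasDerivAt_besselW hμ hx)).congr_deriv ?_
  ring

theorem hasDerivAt_besselW_neg {μ x : ℝ} (hμ : -1 < μ) (hx : 0 < x) :
    HasDerivAt (besselW (-1) (-μ) μ)
      (besselW (-1) (-μ) μ x + besselW (-1) (-μ) (μ + 1) x) x := by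
  have h := (hasDerivAt_besselW_sub hμ hx).add
    (hasDerivAt_besselW (γ := -1) (a := -μ) hμ hx)
  have he : besselW (-1) (-μ) μ = (fun t => besselW (-1) (-μ) μ t -
    besselW (-1) (-μ) (μ + 1) t) + besselW (-1) (-μ) (μ + 1) := by
    funext t; simp
  rw [he]
  refine h.congr_deriv ?_
  simp only [Pi.add_apply]
  ring

/-- The function `e^x x^{-μ} (I_μ - I_{μ+1})` is nondecreasing because `2μ + 1 ≥ 0`, and its limit
at `0+` is `2^{-μ}/Γ(μ+1) > 0`. -/
theorem besselI_add_one_lt {μ x : ℝ} (hμ : -1 / 2 ≤ μ) (hx : 0 < x) :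
    besselI (μ + 1) x < besselI μ x := by
  have hm : MonotoneOn (fun t => besselW (-1) (-μ) μ t - besselW (-1) (-μ) (μ + 1) t)
      (Ioi 0) := by
    refine monotoneOn_Ioi_of_hasDerivAt (fun x hx => hasDerivAt_besselW_sub (by linarith) hx)
      (fun x hx => ?_)
    have : 0 < besselW (-1) (-μ) (μ + 1) x := besselW_pos (by linarith) hx
    have : 0 ≤ 2 * μ + 1 := by linarith
    positivity
  have hl : Tendsto (fun t => besselW (-1) (-μ) μ t - besselW (-1) (-μ) (μ + 1) t) (𝓝[>] 0)
      (𝓝 ((2 ^ μ)⁻¹ * besselS μ 0)) := by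
    have h1 : Tendsto (besselW (-1) (-μ) μ) (𝓝[>] 0) (𝓝 ((2 ^ μ)⁻¹ * besselS μ 0)) := by
      have h2 := ((continuous_besselW_factor (γ := -1) (μ := μ) (by linarith)).tendsto 0).mono_left
        (nhdsWithin_le_nhds (s := Ioi 0))
      simp only [mul_zero, Real.exp_zero, one_mul, zero_div, ne_eq, OfNat.ofNat_ne_zero,
        not_false_eq_true, zero_pow] at h2
      refine h2.congr' ?_
      filter_upwards [self_mem_nhdsWithin] with t ht
      rw [besselW_eq ht]
      simp
    simpa using h1.sub (tendsto_besselW_zero (γ := -1) (a := -μ) (μ := μ + 1) (by linarith)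
      (by linarith))
  have h := (mul_pos (by positivity) (besselS_zero_pos (μ := μ) (by linarith))).trans_le
    (hm.le_of_tendsto_nhdsGT hl hx)
  have h' : 0 < Real.exp (-(-1) * x) * x ^ (-μ) * (besselI μ x - besselI (μ + 1) x) := by
    simp only [besselW] at h
    rw [mul_sub]
    exact h
  exact sub_pos.1 ((mul_pos_iff_of_pos_left (by positivity)).1 h')

theorem besselW_add_one_lt {γ a μ x : ℝ} (hμ : -1 / 2 ≤ μ) (hx : 0 < x) :
    besselW γ a (μ + 1) x < besselW γ a μ x :=
  mul_lt_mul_of_pos_left (besselI_add_one_lt hμ hx) (by positivity)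

/-! ### Upper bounds with exponential -/

/-- The choice `a = μ + 1` removes the `1/x` term, leaving `W_{μ+1}' = W_μ - γ W_{μ+1} > (1-γ) W_μ`.
-/
theorem integral_besselW_lt_one_sub {γ μ x : ℝ} (hγ : 0 < γ) (hγ1 : γ < 1) (hμ : -1 / 2 ≤ μ)
    (hx : 0 < x) :
    ∫ t in (0 : ℝ)..x, besselW γ (μ + 1) μ t < 1 / (1 - γ) * besselW γ (μ + 1) (μ + 1) x := by
  refine lt_of_hasDerivAt_lt (fun x hx => hasDerivAt_integral_besselW (by linarith)
    (by linarith) hx) (fun x hx => (hasDerivAt_besselW (by linarith) hx).const_mul _)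
    (fun x hx => ?_) (tendsto_integral_besselW_zero (by linarith) (by linarith))
    (by simpa using (tendsto_besselW_zero (by linarith) (by linarith)).const_mul (1 / (1 - γ))) hx
  have h := mul_lt_mul_of_pos_left (besselW_add_one_lt (γ := γ) (a := μ + 1) hμ hx) hγ
  rw [one_div, lt_inv_mul_iff₀ (by linarith), sub_self, zero_div, zero_add]
  linarith

/-- The integral of `t^a I_μ(t)` is at most `x^a I_μ(x)` when `a = μ ≥ 1/2`. -/
theorem integral_besselW_zero_le {ν x : ℝ} (hν : 1 / 2 ≤ ν) (hx : 0 < x) :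
    ∫ t in (0 : ℝ)..x, besselW 0 ν ν t ≤ besselW 0 ν ν x := by
  obtain ⟨μ, rfl⟩ : ∃ μ, ν = μ + 1 := ⟨ν - 1, by ring⟩
  refine le_of_hasDerivAt_le (fun x hx => hasDerivAt_integral_besselW (by linarith)
    (by linarith) hx) (fun x hx => hasDerivAt_besselW (by linarith) hx) (fun x hx => ?_)
    (tendsto_integral_besselW_zero (by linarith) (by linarith))
    (tendsto_besselW_zero (by linarith) (by linarith)) hx
  have := besselW_add_one_lt (γ := 0) (a := μ + 1) (μ := μ) (by linarith) hx
  simp only [sub_self, zero_div, zero_add, zero_mul, sub_zero]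
  exact this.le

/-- Let `F` be the integral with `γ = 0`. Since `F ≤ F'`, the derivative `e^{-γx}(F' - γF)` of
`e^{-γx} F` is at least `(1-γ) e^{-γx} F'`. This reduces the exponential bound to the case `γ = 0`.
-/
theorem integral_besselW_le_integral_zero {γ ν x : ℝ} (hγ : 0 < γ) (hγ1 : γ < 1)
    (hν : 1 / 2 ≤ ν) (hx : 0 < x) :
    ∫ t in (0 : ℝ)..x, besselW γ ν ν t ≤
      1 / (1 - γ) * (Real.exp (-γ * x) * ∫ t in (0 : ℝ)..x, besselW 0 ν ν t) := by
  have he : ∀ x, HasDerivAt (fun t => Real.exp (-γ * t)) (Real.exp (-γ * x) * (-γ * 1)) x :=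
    fun x => ((hasDerivAt_id x).const_mul (-γ)).exp
  refine le_of_hasDerivAt_le (fun x hx => hasDerivAt_integral_besselW (by linarith)
    (by linarith) hx) (fun x hx => ((he x).mul
      (hasDerivAt_integral_besselW (by linarith) (by linarith) hx)).const_mul _)
    (fun x hx => ?_) (tendsto_integral_besselW_zero (by linarith) (by linarith)) ?_ hx
  · have h := mul_le_mul_of_nonneg_left (integral_besselW_zero_le hν hx) hγ.le
    have h' := mul_le_mul_of_nonneg_left h (Real.exp_pos (-γ * x)).le
    rw [one_div, le_inv_mul_iff₀ (by linarith), besselW_mul_exp]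
    linarith
  · have h1 : Tendsto (fun t => Real.exp (-γ * t)) (𝓝[>] 0) (𝓝 (Real.exp (-γ * 0))) :=
      ((he 0).continuousAt.tendsto).mono_left nhdsWithin_le_nhds
    simpa [Pi.mul_def] using (h1.mul (tendsto_integral_besselW_zero (γ := 0) (a := ν) (μ := ν)
      (by linarith) (by linarith))).const_mul (1 / (1 - γ))

/-! ### Sharpness of the constants -/

theorem integral_besselW_zero_eq {μ x : ℝ} (hμ : -1 < μ) (hx : 0 < x) :
    ∫ t in (0 : ℝ)..x, besselW 0 (μ + 1) μ t = besselW 0 (μ + 1) (μ + 1) x := by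
  have h1 : ∀ x : ℝ, 0 < x → HasDerivAt (besselW 0 (μ + 1) (μ + 1)) (besselW 0 (μ + 1) μ x) x :=
    fun x hx => (hasDerivAt_besselW hμ hx).congr_deriv (by simp)
  have h2 : ∀ x : ℝ, 0 < x → HasDerivAt (fun y => ∫ t in (0 : ℝ)..y, besselW 0 (μ + 1) μ t)
      (besselW 0 (μ + 1) μ x) x := fun x hx => hasDerivAt_integral_besselW hμ (by linarith) hx
  have t1 := tendsto_besselW_zero (γ := 0) (a := μ + 1) (μ := μ + 1) (by linarith) (by linarith)
  have t2 := tendsto_integral_besselW_zero (γ := 0) (a := μ + 1) hμ (by linarith)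
  exact le_antisymm (le_of_hasDerivAt_le h2 h1 (fun _ _ => le_rfl) t2 t1 hx)
    (le_of_hasDerivAt_le h1 h2 (fun _ _ => le_rfl) t1 t2 hx)

/-- Dropping `e^{-γt} ≤ 1` makes the integral exact, so `M e^{-γx} ≤ 1`; let `x → 0`. -/
theorem le_one_of_mul_besselW_le_integral {γ μ M : ℝ} (hγ : 0 < γ) (hμ : -1 < μ)
    (h : ∀ x : ℝ, 0 < x →
      M * besselW γ (μ + 1) (μ + 1) x ≤ ∫ t in (0 : ℝ)..x, besselW γ (μ + 1) μ t) : M ≤ 1 := by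
  have h1 : ∀ x : ℝ, 0 < x → M * Real.exp (-γ * x) ≤ 1 := by
    intro x hx
    have h2 : ∫ t in (0 : ℝ)..x, besselW γ (μ + 1) μ t ≤
        ∫ t in (0 : ℝ)..x, besselW 0 (μ + 1) μ t := by
      refine intervalIntegral.integral_mono_on_of_le_Ioo hx.le
        (intervalIntegrable_besselW hμ (by linarith) hx)
        (intervalIntegrable_besselW hμ (by linarith) hx) fun t ht => ?_
      rw [besselW_mul_exp]
      refine mul_le_of_le_one_left (besselW_pos hμ ht.1).le (Real.exp_le_one_iff.2 ?_)
      nlinarith [ht.1]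
    have h3 := (h x hx).trans h2
    have hp : 0 < besselW 0 (μ + 1) (μ + 1) x := besselW_pos (by linarith) hx
    rw [integral_besselW_zero_eq hμ hx, besselW_mul_exp, ← mul_assoc] at h3
    exact (mul_le_iff_le_one_left hp).1 h3
  have h2 : Tendsto (fun x => M * Real.exp (-γ * x)) (𝓝[>] 0) (𝓝 (M * Real.exp (-γ * 0))) :=
    ((by fun_prop : Continuous fun x => M * Real.exp (-γ * x)).tendsto 0).mono_left
      nhdsWithin_le_nhds
  simp only [mul_zero, Real.exp_zero, mul_one] at h2
  refine le_of_tendsto h2 ?_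
  filter_upwards [self_mem_nhdsWithin] with x hx using h1 x hx

/-- Compares leading terms at `0`: bounding `S_μ` below by `S_μ(0)` integrates to a power of `x`,
and `S_μ(0) = (μ+1) S_{μ+1}(0)` produces the constant. -/
theorem le_of_integral_besselW_zero_le {a μ M : ℝ} (hμ : -1 < μ) (h : -1 < a + μ)
    (hM : ∀ x : ℝ, 0 < x →
      ∫ t in (0 : ℝ)..x, besselW 0 a μ t ≤ M * besselW 0 a (μ + 1) x) :
    2 * (μ + 1) / (a + μ + 1) ≤ M := by
  have hD : 0 < a + μ + 1 := by linarith
  have hS := besselS_zero_pos (μ := μ + 1) (by linarith)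
  have hS0 : besselS μ 0 = (μ + 1) * besselS (μ + 1) 0 := by
    simpa using besselS_recurrence hμ le_rfl
  have h1 : ∀ x : ℝ, 0 < x → 2 * (μ + 1) / (a + μ + 1) * besselS (μ + 1) 0 ≤
      M * besselS (μ + 1) ((x / 2) ^ 2) := by
    intro x hx
    have h2 : ∀ x : ℝ, 0 < x → (2 ^ μ)⁻¹ * besselS μ 0 * (x ^ (a + μ + 1) / (a + μ + 1)) ≤
        ∫ t in (0 : ℝ)..x, besselW 0 a μ t := by
      intro x hx
      refine le_of_hasDerivAt_le (fun x hx => ((Real.hasDerivAt_rpow_const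
        (p := a + μ + 1) (Or.inl hx.ne')).div_const (a + μ + 1)).const_mul
          ((2 ^ μ)⁻¹ * besselS μ 0))
        (fun x hx => hasDerivAt_integral_besselW hμ h hx) (fun x hx => ?_) ?_
        (tendsto_integral_besselW_zero hμ h) hx
      · rw [besselW_eq hx, mul_div_cancel_left₀ _ hD.ne', add_sub_cancel_right]
        simp only [neg_zero, zero_mul, Real.exp_zero, one_mul]
        rw [mul_comm]
        have := besselS_zero_le hμ (sq_nonneg (x / 2))
        gcongr
      · have := (Real.continuousAt_rpow_const 0 (a + μ + 1) (Or.inr hD.le)).tendsto.mono_left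
          (nhdsWithin_le_nhds (s := Ioi 0))
        rw [Real.zero_rpow hD.ne'] at this
        simpa using (this.div_const (a + μ + 1)).const_mul ((2 ^ μ)⁻¹ * besselS μ 0)
    have h3 := (h2 x hx).trans (hM x hx)
    rw [besselW_eq hx, ← add_assoc] at h3
    simp only [neg_zero, zero_mul, Real.exp_zero, one_mul] at h3
    have hp : 0 < (2 ^ (μ + 1))⁻¹ * x ^ (a + μ + 1) := by positivity
    refine le_of_mul_le_mul_left ?_ hp
    refine le_trans (le_of_eq ?_) (h3.trans (le_of_eq ?_))
    · rw [hS0, Real.rpow_add_one two_ne_zero]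
      field_simp
    · ring
  have h2 : Tendsto (fun x => M * besselS (μ + 1) ((x / 2) ^ 2)) (𝓝[>] 0)
      (𝓝 (M * besselS (μ + 1) ((0 / 2) ^ 2))) := by
    have hc := (continuous_besselS (μ := μ + 1) (by linarith)).comp
      (f := fun t : ℝ => (t / 2) ^ 2) (by fun_prop)
    exact ((hc.tendsto 0).const_mul M).mono_left nhdsWithin_le_nhds
  have h3 := ge_of_tendsto h2 (b := 2 * (μ + 1) / (a + μ + 1) * besselS (μ + 1) 0) (by
    filter_upwards [self_mem_nhdsWithin] with x hx using h1 x hx)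
  norm_num at h3
  exact le_of_mul_le_mul_right h3 hS

theorem tendsto_besselW_neg_atTop {μ : ℝ} (hμ : -1 < μ) :
    Tendsto (besselW (-1) (-μ) μ) atTop atTop := by
  have hS := besselS_zero_pos hμ
  have h1 : Tendsto (fun x => Real.exp x * ((2 ^ μ)⁻¹ * besselS μ 0)) atTop atTop :=
    Real.tendsto_exp_atTop.atTop_mul_const (by positivity)
  refine tendsto_atTop_mono' _ ?_ h1
  filter_upwards [eventually_gt_atTop 0] with x hx
  rw [besselW_eq hx]
  have := besselS_zero_le hμ (sq_nonneg (x / 2))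
  simp only [neg_add_cancel, Real.rpow_zero, one_mul, neg_neg]
  rw [mul_assoc]
  gcongr

/-- The ratio `I_{μ+1}(x) / I_μ(x)` tends to at least `1` at infinity. -/
theorem eventually_le_besselI_add_one {μ ε : ℝ} (hμ : -1 / 2 ≤ μ) (hε : 0 < ε) :
    ∀ᶠ x in atTop, (1 - ε) * besselI μ x ≤ besselI (μ + 1) x := by
  have hμ1 : -1 < μ := by linarith
  -- Beyond `X` the coefficient `(2μ+1)/x` is at most `ε/2`, so `(ε/2) W_μ - (W_μ - W_{μ+1})` is
  -- nondecreasing. It is thus bounded below by `C`, which the other `ε/2` absorbs because `W_μ →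
  -- ∞`.
  set X : ℝ := max 1 ((2 * μ + 1) / (ε / 2)) with hX
  have hX0 : 0 < X := lt_of_lt_of_le one_pos (le_max_left _ _)
  have hm := monotoneOn_Ioi_of_hasDerivAt (c := X)
    (fun x hx => ((hasDerivAt_besselW_neg hμ1 (hX0.trans hx)).const_mul (ε / 2)).sub
      (hasDerivAt_besselW_sub hμ1 (hX0.trans hx))) (fun x hx => by
      have hx0 := hX0.trans hx
      have h1 : (2 * μ + 1) / x ≤ ε / 2 := by
        rw [div_le_comm₀ hx0 (by positivity)]
        exact (le_max_right _ _).trans hx.le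
      have h2 : 0 < besselW (-1) (-μ) μ x := besselW_pos hμ1 hx0
      have h3 : 0 < besselW (-1) (-μ) (μ + 1) x := besselW_pos (by linarith) hx0
      have h4 := mul_le_mul_of_nonneg_right h1 h3.le
      have h5 := mul_pos hε h2
      linarith)
  set C := ε / 2 * besselW (-1) (-μ) μ (X + 1) -
    (besselW (-1) (-μ) μ (X + 1) - besselW (-1) (-μ) (μ + 1) (X + 1)) with hC
  filter_upwards [eventually_ge_atTop (X + 1),
    (tendsto_besselW_neg_atTop hμ1).eventually_ge_atTop (-C / (ε / 2))] with x hx hx'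
  have hx0 : 0 < x := by linarith
  have h1 : C ≤ ε / 2 * besselW (-1) (-μ) μ x -
      (besselW (-1) (-μ) μ x - besselW (-1) (-μ) (μ + 1) x) :=
    hm (by simp) (by simp; linarith) hx
  rw [div_le_iff₀ (by positivity)] at hx'
  have h2 : (1 - ε) * besselW (-1) (-μ) μ x ≤ besselW (-1) (-μ) (μ + 1) x := by linarith
  simp only [besselW] at h2
  have hp : 0 < Real.exp (-(-1) * x) * x ^ (-μ) := by positivity
  exact le_of_mul_le_mul_left (by linarith) hp

theorem tendsto_besselW_atTop {γ μ : ℝ} (hγ : 0 < γ) (hγ1 : γ < 1) (hμ : -1 / 2 ≤ μ) :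
    Tendsto (besselW γ (μ + 1) (μ + 1)) atTop atTop := by
  have hμ1 : -1 < μ := by linarith
  have he : ∀ x, HasDerivAt (fun t => Real.exp (-(1 - γ) * t))
      (Real.exp (-(1 - γ) * x) * (-(1 - γ) * 1)) x :=
    fun x => ((hasDerivAt_id x).const_mul (-(1 - γ))).exp
  -- The product is `e^{-x} x^{μ+1} I_{μ+1}`, nondecreasing by `I_{μ+1} < I_μ`; hence growth at
  -- least like `e^{(1-γ)x}`.
  have hm := monotoneOn_Ioi_of_hasDerivAt (c := 0)
    (fun x hx => (he x).mul (hasDerivAt_besselW (γ := γ) (a := μ + 1) hμ1 hx)) (fun x hx => by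
      have h := mul_lt_mul_of_pos_left (besselW_add_one_lt (γ := γ) (a := μ + 1) hμ hx)
        (Real.exp_pos (-(1 - γ) * x))
      simp only [sub_self, zero_div, zero_add]
      linarith)
  set c := Real.exp (-(1 - γ) * 1) * besselW γ (μ + 1) (μ + 1) 1 with hc
  have hc0 : 0 < c := mul_pos (Real.exp_pos _) (besselW_pos (by linarith) one_pos)
  have ht : Tendsto (fun x => Real.exp ((1 - γ) * x) * c) atTop atTop :=
    (Real.tendsto_exp_atTop.comp (tendsto_id.const_mul_atTop (by linarith))).atTop_mul_const hc0
  refine tendsto_atTop_mono' _ ?_ ht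
  filter_upwards [eventually_ge_atTop 1] with x hx
  have h1 : c ≤ Real.exp (-(1 - γ) * x) * besselW γ (μ + 1) (μ + 1) x :=
    hm (by simp) (by simp; linarith) hx
  calc Real.exp ((1 - γ) * x) * c
      ≤ Real.exp ((1 - γ) * x) * (Real.exp (-(1 - γ) * x) * besselW γ (μ + 1) (μ + 1) x) := by
        gcongr
    _ = besselW γ (μ + 1) (μ + 1) x := by
        rw [← mul_assoc, ← Real.exp_add, neg_mul, add_neg_cancel, Real.exp_zero, one_mul]

theorem one_div_one_sub_le_of_integral_le {γ μ M : ℝ} (hγ : 0 < γ) (hγ1 : γ < 1)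
    (hμ : -1 / 2 ≤ μ)
    (h : ∀ x : ℝ, 0 < x →
      ∫ t in (0 : ℝ)..x, besselW γ (μ + 1) μ t ≤ M * besselW γ (μ + 1) (μ + 1) x) :
    1 / (1 - γ) ≤ M := by
  have hμ1 : -1 < μ := by linarith
  have hlt : ∀ x : ℝ, 0 < x →
      besselW γ (μ + 1) (μ + 1) x < ∫ t in (0 : ℝ)..x, besselW γ (μ + 1) μ t := fun x hx =>
    besselW_add_one_lt_integral hγ hμ1 le_rfl (by linarith) hx
  have hF : Tendsto (fun x => ∫ t in (0 : ℝ)..x, besselW γ (μ + 1) μ t) atTop atTop := by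
    refine tendsto_atTop_mono' _ ?_ (tendsto_besselW_atTop hγ hγ1 hμ)
    filter_upwards [eventually_gt_atTop 0] with x hx using (hlt x hx).le
  have hM : 0 < M := by
    have hW : 0 < besselW γ (μ + 1) (μ + 1) 1 := besselW_pos (by linarith) one_pos
    exact (pos_iff_pos_of_mul_pos (((hW.trans (hlt 1 one_pos)).trans_le (h 1 one_pos)))).2 hW
  -- For large `x`, `W_{μ+1}' = W_μ - γ W_{μ+1} ≤ (1 - γ(1-ε)) W_μ`. Integrating gives `W_{μ+1} ≤ (1
  -- - γ(1-ε)) F - C`, where `F` is the integral.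
  have key : ∀ ε : ℝ, 0 < ε → 1 ≤ M * (1 - γ * (1 - ε) + ε) := by
    intro ε hε
    obtain ⟨X, hX⟩ := eventually_atTop.1 (eventually_le_besselI_add_one hμ hε)
    set Y := max X 1 with hY
    have hY0 : 0 < Y := lt_of_lt_of_le one_pos (le_max_right _ _)
    have hm := monotoneOn_Ioi_of_hasDerivAt (c := Y)
      (fun x hx => ((hasDerivAt_integral_besselW (γ := γ) (a := μ + 1) hμ1 (by linarith)
        (hY0.trans hx)).const_mul (1 - γ * (1 - ε))).sub
        (hasDerivAt_besselW (γ := γ) (a := μ + 1) hμ1 (hY0.trans hx))) (fun x hx => by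
        have hx0 := hY0.trans hx
        have h1 := hX x ((le_max_left _ _).trans hx.le)
        have h2 : (1 - ε) * besselW γ (μ + 1) μ x ≤ besselW γ (μ + 1) (μ + 1) x := by
          have hp : 0 < Real.exp (-γ * x) * x ^ (μ + 1) := by positivity
          have := mul_le_mul_of_nonneg_left h1 hp.le
          simp only [besselW]
          linarith
        have h3 := mul_le_mul_of_nonneg_left h2 hγ.le
        simp only [sub_self, zero_div, zero_add]
        linarith)
    set C := (1 - γ * (1 - ε)) * (∫ t in (0 : ℝ)..(Y + 1), besselW γ (μ + 1) μ t) -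
      besselW γ (μ + 1) (μ + 1) (Y + 1) with hC
    -- `F ≥ -C/ε` absorbs the constant into `εF`, and `F ≥ 1` permits cancelling `F` at the end.
    obtain ⟨x, hx, hx'⟩ := ((eventually_ge_atTop (Y + 1)).and
      (hF.eventually_ge_atTop (max 1 (-C / ε)))).exists
    have h1 : C ≤ (1 - γ * (1 - ε)) * (∫ t in (0 : ℝ)..x, besselW γ (μ + 1) μ t) -
      besselW γ (μ + 1) (μ + 1) x := hm (by simp) (by simp; linarith) hx
    have h2 := h x (by linarith)
    have h3 := (le_max_right _ _).trans hx'
    have h4 := one_pos.trans_le ((le_max_left _ _).trans hx')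
    generalize (∫ t in (0 : ℝ)..x, besselW γ (μ + 1) μ t) = F at *
    rw [div_le_iff₀ hε] at h3
    have h5 := mul_le_mul_of_nonneg_left
      (show besselW γ (μ + 1) (μ + 1) x ≤ (1 - γ * (1 - ε) + ε) * F by linarith) hM.le
    refine le_of_mul_le_mul_right ?_ h4
    linarith
  have ht : Tendsto (fun ε : ℝ => M * (1 - γ * (1 - ε) + ε)) (𝓝[>] 0)
      (𝓝 (M * (1 - γ * (1 - 0) + 0))) :=
    ((by fun_prop : Continuous fun ε : ℝ => M * (1 - γ * (1 - ε) + ε)).tendsto 0).mono_left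
      nhdsWithin_le_nhds
  have h1 := ge_of_tendsto ht (by filter_upwards [self_mem_nhdsWithin] with ε hε using key ε hε)
  rw [div_le_iff₀ (by linarith)]
  simpa using h1

/-! ### Assembly of the theorem -/

theorem besselW_zero_eq (a μ : ℝ) : besselW 0 a μ = fun t => t ^ a * besselI μ t := by
  funext t
  simp [besselW]

theorem mainTheorem2 :
    -- lower bound for the integral of `e^{-γt} t^ν I_{ν+n}(t)`
    (∀ γ n ν : ℝ, 0 < γ → -1 < n → -(1 / 2) * (n + 1) < ν → ∀ x : ℝ, 0 < x →
      IntervalIntegrable (fun t => Real.exp (-γ * t) * t ^ ν * besselI (ν + n) t)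
        MeasureTheory.volume 0 x ∧
      Real.exp (-γ * x) * x ^ ν * besselI (ν + n + 1) x
        < ∫ t in (0 : ℝ)..x, Real.exp (-γ * t) * t ^ ν * besselI (ν + n) t) ∧
    -- refined and simple upper bounds for the integral of `t^ν I_{ν+n}(t)`
    (∀ n ν : ℝ, -1 < n → -(1 / 2) * (n + 1) < ν → ∀ x : ℝ, 0 < x →
      IntervalIntegrable (fun t => t ^ ν * besselI (ν + n) t) MeasureTheory.volume 0 x ∧
      (∫ t in (0 : ℝ)..x, t ^ ν * besselI (ν + n) t)
        < x ^ ν / (2 * ν + n + 1) *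
          (2 * (ν + n + 1) * besselI (ν + n + 1) x - (n + 1) * besselI (ν + n + 3) x) ∧
      x ^ ν / (2 * ν + n + 1) *
          (2 * (ν + n + 1) * besselI (ν + n + 1) x - (n + 1) * besselI (ν + n + 3) x)
        < 2 * (ν + n + 1) / (2 * ν + n + 1) * (x ^ ν * besselI (ν + n + 1) x)) ∧
    -- the constant in the simple upper bound is best possible
    (∀ n ν : ℝ, -1 < n → -(1 / 2) * (n + 1) < ν → ∀ M : ℝ,
      (∀ x : ℝ, 0 < x →
        (∫ t in (0 : ℝ)..x, t ^ ν * besselI (ν + n) t) ≤ M * (x ^ ν * besselI (ν + n + 1) x)) →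
      2 * (ν + n + 1) / (2 * ν + n + 1) ≤ M) ∧
    -- upper bound for the integral of `e^{-γt} t^ν I_ν(t)`
    (∀ γ ν : ℝ, 0 < γ → γ < 1 → 1 / 2 ≤ ν → ∀ x : ℝ, 0 < x →
      IntervalIntegrable (fun t => Real.exp (-γ * t) * t ^ ν * besselI ν t)
        MeasureTheory.volume 0 x ∧
      (∫ t in (0 : ℝ)..x, Real.exp (-γ * t) * t ^ ν * besselI ν t)
        < Real.exp (-γ * x) * x ^ ν / ((2 * ν + 1) * (1 - γ)) *
          (2 * (ν + 1) * besselI (ν + 1) x - besselI (ν + 3) x)) ∧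
    -- lower bound for the integral of `e^{-γt} t^{ν+1} I_ν(t)`
    (∀ γ ν : ℝ, 0 < γ → -1 < ν → ∀ x : ℝ, 0 < x →
      IntervalIntegrable (fun t => Real.exp (-γ * t) * t ^ (ν + 1) * besselI ν t)
        MeasureTheory.volume 0 x ∧
      Real.exp (-γ * x) * x ^ (ν + 1) * besselI (ν + 1) x
        < ∫ t in (0 : ℝ)..x, Real.exp (-γ * t) * t ^ (ν + 1) * besselI ν t) ∧
    -- its constant `1` is best possible
    (∀ γ ν : ℝ, 0 < γ → -1 < ν → ∀ M : ℝ,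
      (∀ x : ℝ, 0 < x →
        M * (Real.exp (-γ * x) * x ^ (ν + 1) * besselI (ν + 1) x)
          ≤ ∫ t in (0 : ℝ)..x, Real.exp (-γ * t) * t ^ (ν + 1) * besselI ν t) →
      M ≤ 1) ∧
    -- upper bound for the integral of `e^{-γt} t^{ν+1} I_ν(t)`
    (∀ γ ν : ℝ, 0 < γ → γ < 1 → -(1 / 2) < ν → ∀ x : ℝ, 0 < x →
      (∫ t in (0 : ℝ)..x, Real.exp (-γ * t) * t ^ (ν + 1) * besselI ν t)
        < 1 / (1 - γ) * (Real.exp (-γ * x) * x ^ (ν + 1) * besselI (ν + 1) x)) ∧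
    -- its constant is best possible
    (∀ γ ν : ℝ, 0 < γ → γ < 1 → -(1 / 2) < ν → ∀ M : ℝ,
      (∀ x : ℝ, 0 < x →
        (∫ t in (0 : ℝ)..x, Real.exp (-γ * t) * t ^ (ν + 1) * besselI ν t)
          ≤ M * (Real.exp (-γ * x) * x ^ (ν + 1) * besselI (ν + 1) x)) →
      1 / (1 - γ) ≤ M) := by
  -- With `a = ν`, `μ = ν + n`, the hypothesis on `ν` is exactly `a + μ > -1`, and together with `n
  -- > -1` it gives `μ > -1`; also `μ + 1 - a = n + 1`.
  refine ⟨fun γ n ν hγ hn hν x hx => ⟨?_, ?_⟩, fun n ν hn hν x hx => ⟨?_, ?_, ?_⟩,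
    fun n ν hn hν M hM => ?_, fun γ ν hγ hγ1 hν x hx => ⟨?_, ?_⟩,
    fun γ ν hγ hν x hx => ⟨?_, ?_⟩, fun γ ν hγ hν M hM => ?_, fun γ ν hγ hγ1 hν x hx => ?_,
    fun γ ν hγ hγ1 hν M hM => ?_⟩
  · exact intervalIntegrable_besselW (by linarith) (by linarith) hx
  · exact besselW_add_one_lt_integral hγ (by linarith) (by linarith) (by linarith) hx
  · rw [← besselW_zero_eq]
    exact intervalIntegrable_besselW (by linarith) (by linarith) hx
  · have h := integral_besselW_zero_lt (a := ν) (μ := ν + n) (by linarith) (by linarith)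
      (by linarith) hx
    rw [besselW_zero_eq, besselW_zero_eq, besselW_zero_eq] at h
    refine h.trans_eq ?_
    rw [show ν + (ν + n) + 1 = 2 * ν + n + 1 by ring]
    ring
  · have h1 := besselI_pos (μ := ν + n + 3) (by linarith) hx
    have h2 : 0 < 2 * ν + n + 1 := by linarith
    have h3 := mul_pos (by linarith : 0 < n + 1) h1
    calc _ < x ^ ν / (2 * ν + n + 1) * (2 * (ν + n + 1) * besselI (ν + n + 1) x) :=
          mul_lt_mul_of_pos_left (sub_lt_self _ h3) (by positivity)
      _ = _ := by ring
  · have h := le_of_integral_besselW_zero_le (a := ν) (μ := ν + n) (M := M) (by linarith)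
      (by linarith) (by simpa only [besselW_zero_eq] using hM)
    rwa [show ν + (ν + n) + 1 = 2 * ν + n + 1 by ring] at h
  · exact intervalIntegrable_besselW (by linarith) (by linarith) hx
  · have h1 := integral_besselW_le_integral_zero hγ hγ1 hν hx
    have h2 := integral_besselW_zero_lt (a := ν) (μ := ν) (by linarith) (by linarith)
      (by linarith) hx
    have hγ' : 0 < 1 - γ := by linarith
    have h3 := h1.trans_lt (mul_lt_mul_of_pos_left
      (mul_lt_mul_of_pos_left h2 (Real.exp_pos (-γ * x))) (by positivity : 0 < 1 / (1 - γ)))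
    refine h3.trans_eq ?_
    have h4 : 0 < 2 * ν + 1 := by linarith
    rw [besselW_zero_eq, besselW_zero_eq, show ν + ν + 1 = 2 * ν + 1 by ring]
    field_simp
    ring
  · exact intervalIntegrable_besselW hν (by linarith) hx
  · exact besselW_add_one_lt_integral hγ hν le_rfl (by linarith) hx
  · exact le_one_of_mul_besselW_le_integral hγ hν hM
  · exact integral_besselW_lt_one_sub hγ hγ1 (by linarith) hx
  · exact one_div_one_sub_le_of_integral_le hγ hγ1 (by linarith) hM
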